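/- For real $x>1$ put $C(x)=\sum_{r=-\infty}^{\infty}x^{-r^2}$ and $D(x)=\prod_{j=1}^{\infty}\frac{1}{1-x^{-j}}$. For integers $0\le k\le n$ let $\binom{n}{k}_x=\frac{(x^n-1)(x^n-x)\cdots(x^n-x^{k-1})}{(x^k-1)(x^k-x)\cdots(x^k-x^{k-1})}$ be the Gaussian coefficient, and let $\mathcal G_n(x)=\sum_{k=0}^{n}\binom{n}{k}_x$ be the Galois number. Theorem 6.2. Let $p$ be a prime, let $d\ge 0$ be an integer, let $g\in\mathrm{GL}(d,\mathbb F_p)$, and let $M$ be a finite module over the group algebra $\mathbb F_p\langle g\rangle$ of the cyclic group $\langle g\rangle$. Let $m=\dim_{\mathbb F_p}M$ and let $S_M$ be the number of $\mathbb F_p\langle g\rangle$-submodules of $M$. Then exactly one of the following holds: (a) $g$ acts on $M$ as a scalar (that is, as multiplication by an element of $\mathbb F_p$), every $\mathbb F_p$-subspace of $M$ is an $\mathbb F_p\langle g\rangle$-submodule, and $S_M=\mathcal G_m(p)$; or (b) $g$ does not act on $M$ as a scalar, and $$\log_p S_M\le \frac{m^2-2m+2}{4}+2\log_p\bigl(C(p)D(p)\bigr).$$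 -/

import Mathlib

namespace SubmoduleCount

/-- `C(x) = ∑_{r ∈ ℤ} x ^ (-r²)`, for real `x > 1` (the series then converges absolutely). -/
noncomputable def C (x : ℝ) : ℝ := ∑' r : ℤ, x ^ (-(r ^ 2))

/-- `D(x) = ∏_{j ≥ 1} 1 / (1 - x ^ (-j))`, for real `x > 1` (the product then converges
absolutely). The index is shifted by one, so that `j : ℕ` stands for the factor `j + 1`. -/
noncomputable def D (x : ℝ) : ℝ := ∏' j : ℕ, 1 / (1 - x ^ (-((j : ℤ) + 1)))

/-- The Gaussian coefficient
`((q^n - 1) ⋯ (q^n - q^(k-1))) / ((q^k - 1) ⋯ (q^k - q^(k-1)))`. -/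
noncomputable def gaussCoeff (n k : ℕ) (q : ℝ) : ℝ :=
  (∏ i ∈ Finset.range k, (q ^ n - q ^ i)) / ∏ i ∈ Finset.range k, (q ^ k - q ^ i)

/-- The Galois number: the sum over `0 ≤ k ≤ n` of the Gaussian coefficients. -/
noncomputable def galoisNumber (n : ℕ) (q : ℝ) : ℝ :=
  ∑ k ∈ Finset.range (n + 1), gaussCoeff n k q

/-- The group algebra `𝔽_p⟨g⟩` of the cyclic group generated by `g` in `GL(d, 𝔽_p)`. -/
abbrev CyclicAlg (p d : ℕ) (g : Matrix.GeneralLinearGroup (Fin d) (ZMod p)) : Type :=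
  MonoidAlgebra (ZMod p) (Subgroup.zpowers g)

/-- The element `g` of the group algebra `𝔽_p⟨g⟩`. -/
noncomputable def CyclicAlg.gen (p d : ℕ) (g : Matrix.GeneralLinearGroup (Fin d) (ZMod p)) :
    CyclicAlg p d g :=
  MonoidAlgebra.of (ZMod p) (Subgroup.zpowers g) ⟨g, Subgroup.mem_zpowers g⟩

/-- `g` acts on `M` as multiplication by an element of `𝔽_p`. -/
def ActsAsScalar (p d : ℕ) (g : Matrix.GeneralLinearGroup (Fin d) (ZMod p))
    (M : Type*) [AddCommGroup M] [Module (ZMod p) M] [Module (CyclicAlg p d g) M] : Prop :=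
  ∃ c : ZMod p, ∀ v : M, CyclicAlg.gen p d g • v = c • v

end SubmoduleCount

namespace SubmoduleCount

open Finset Real

/-! Since k(n-k) = n²/4 - (k-n/2)², bounding each Gaussian coefficient by D(q) q^(k(n-k)) gives the
Galois number bound C(q) D(q) q^(n²/4) (`galoisNumber_le`).

If `g` is not scalar, let I be the annihilator of M in the commutative algebra A = 𝔽_p⟨g⟩. One of
three things happens (`card_submodule_le_of_not_scalar`): some element acts as a nonzero N with N² =
0; some element acts as an idempotent other than 0 and 1; or A/I is a field of degree e ≥ 2 over
𝔽_p. In the first two cases the count is at most (CD)² p^((a²+b²)/4) with a + b = m and a, b ≥ 1,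
and a² + b² ≤ (m-1)² + 1. In the third it is a Galois number over a field of size p^e, with exponent
m²/(4e) ≤ m²/8, which is small enough because (m-2)² ≥ 0. -/

/-! ### The theta series C and the Euler product D. -/

theorem summable_rpow_neg_sq {x : ℝ} (hx : 1 < x) (s : ℝ) :
    Summable fun r : ℤ => x ^ (-((r + s) ^ 2) : ℝ) := by
  have hx0 : 0 < x := by linarith
  have hL : 0 < log x := log_pos hx
  have h := (summable_jacobiTheta₂_term_iff (Complex.I * (log x * s / π : ℝ))
    (Complex.I * (log x / π : ℝ))).2 (by
      rw [Complex.I_mul_im, Complex.ofReal_re]; positivity)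
  refine (h.norm.mul_right (exp (-(log x * s ^ 2)))).congr fun r => ?_
  rw [norm_jacobiTheta₂_term, Complex.I_mul_im, Complex.I_mul_im, Complex.ofReal_re,
    Complex.ofReal_re, ← exp_add, rpow_def_of_pos hx0]
  congr 1
  field_simp
  ring

theorem C_eq {x : ℝ} : C x = ∑' r : ℤ, x ^ (-(((r : ℝ) + (0 : ℝ)) ^ 2) : ℝ) := by
  refine tsum_congr fun r => ?_
  rw [← rpow_intCast]
  push_cast
  simp

/-- Poisson summation turns the series shifted by s into a Gaussian series whose n-th term carries a
phase depending on s. Without shift all terms are positive, so the triangle inequality makes the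
unshifted sum the larger one. -/
theorem tsum_rpow_neg_half_sq_le {x : ℝ} (hx : 1 < x) :
    ∑' r : ℤ, x ^ (-(((r : ℝ) + (1 / 2 : ℝ)) ^ 2) : ℝ) ≤ C x := by
  have hx0 : 0 < x := by linarith
  have hL : 0 < log x := log_pos hx
  rw [C_eq]
  set a : ℝ := π / log x with ha
  have ha0 : 0 < a := by positivity
  have key : ∀ s : ℝ, ((∑' r : ℤ, x ^ (-((r + s) ^ 2) : ℝ) : ℝ) : ℂ) =
      (a : ℂ) ^ (1 / 2 : ℂ) *
        ∑' n : ℤ, Complex.exp (-π * a * n ^ 2 + 2 * π * (-Complex.I * s) * n) := by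
    intro s
    have h := Complex.tsum_exp_neg_quadratic (a := (a : ℂ)) (by simpa using ha0) (-Complex.I * s)
    have hne : (a : ℂ) ^ (1 / 2 : ℂ) ≠ 0 := by
      rw [Complex.cpow_ne_zero_iff]; left; exact_mod_cast ha0.ne'
    rw [h, ← mul_assoc, mul_one_div_cancel hne, one_mul, Complex.ofReal_tsum]
    refine tsum_congr fun r => ?_
    rw [rpow_def_of_pos hx0, Complex.ofReal_exp]
    congr 1
    have hI : Complex.I * (-Complex.I * s) = s := by
      rw [← mul_assoc, mul_neg, Complex.I_mul_I]; simp
    have hL' : (log x : ℂ) ≠ 0 := by exact_mod_cast hL.ne'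
    have hpi : (π : ℂ) ≠ 0 := by exact_mod_cast pi_ne_zero
    rw [hI, ha]
    push_cast
    field_simp
  have h0 := key 0
  have h1 := key (1 / 2)
  have hnn : ∀ s : ℝ, 0 ≤ ∑' r : ℤ, x ^ (-((r + s) ^ 2) : ℝ) := fun s =>
    tsum_nonneg fun r => (rpow_pos_of_pos hx0 _).le
  have hsum : Summable fun n : ℤ => exp (-π * a * n ^ 2) := by
    have h := (summable_jacobiTheta₂_term_iff 0 (Complex.I * a)).2 (by
      rw [Complex.I_mul_im, Complex.ofReal_re]; positivity)
    refine h.norm.congr fun r => ?_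
    rw [norm_jacobiTheta₂_term, Complex.I_mul_im, Complex.ofReal_re]
    congr 1
    simp; ring
  have e0 : ∑' n : ℤ, Complex.exp (-π * a * n ^ 2 + 2 * π * (-Complex.I * (0 : ℝ)) * n) =
      ((∑' n : ℤ, exp (-π * a * n ^ 2) : ℝ) : ℂ) := by
    rw [Complex.ofReal_tsum]
    refine tsum_congr fun n => ?_
    push_cast
    simp
  have hnorm : ∀ n : ℤ, ‖Complex.exp (-π * a * n ^ 2 +
      2 * π * (-Complex.I * ((1 / 2 : ℝ) : ℂ)) * n)‖ = exp (-π * a * n ^ 2) := by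
    intro n
    rw [Complex.norm_exp]
    congr 1
    have : (-π * a * n ^ 2 + 2 * π * (-Complex.I * ((1 / 2 : ℝ) : ℂ)) * n : ℂ) =
      ((-π * a * n ^ 2 : ℝ) : ℂ) + ((-π * n : ℝ) : ℂ) * Complex.I := by
      push_cast; ring
    rw [this, Complex.add_re, Complex.re_ofReal_mul, Complex.I_re, Complex.ofReal_re]
    simp
  have e1 : ‖∑' n : ℤ, Complex.exp (-π * a * n ^ 2 +
      2 * π * (-Complex.I * ((1 / 2 : ℝ) : ℂ)) * n)‖ ≤ ∑' n : ℤ, exp (-π * a * n ^ 2) := by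
    refine (norm_tsum_le_tsum_norm ?_).trans_eq (tsum_congr hnorm)
    exact hsum.congr fun n => (hnorm n).symm
  have n0 := congrArg norm h0
  have n1 := congrArg norm h1
  rw [e0, norm_mul, Complex.norm_real, norm_of_nonneg (hnn _), Complex.norm_real,
    norm_of_nonneg (tsum_nonneg fun n => (exp_pos _).le)] at n0
  rw [norm_mul, Complex.norm_real, norm_of_nonneg (hnn _)] at n1
  rw [n0, n1]
  gcongr

theorem sum_rpow_neg_sq_le_C {x : ℝ} (hx : 1 < x) (n : ℕ) :
    ∑ k ∈ range (n + 1), x ^ (-(((k : ℝ) - n / 2) ^ 2)) ≤ C x := by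
  have hx0 : 0 < x := by linarith
  have hshift : ∀ (s : ℝ) (t : ℤ), (t : ℝ) = s + n / 2 →
      ∑ k ∈ range (n + 1), x ^ (-(((k : ℝ) - n / 2) ^ 2)) ≤
        ∑' r : ℤ, x ^ (-((r + s) ^ 2) : ℝ) := by
    intro s t hst
    have hinj : Function.Injective fun k : ℕ => (k : ℤ) - t := fun a b h => by
      simpa using h
    have h := (summable_rpow_neg_sq hx s).sum_le_tsum ((range (n + 1)).map ⟨_, hinj⟩)
      fun r _ => (rpow_pos_of_pos hx0 _).le
    refine le_trans (le_of_eq ?_) h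
    rw [sum_map]
    refine sum_congr rfl fun k _ => ?_
    simp only [Function.Embedding.coeFn_mk]
    push_cast
    rw [hst]
    congr 3
    ring
  -- The numbers k - n/2 are integers for even n and half-integers for odd n.
  rcases Nat.even_or_odd' n with ⟨c, hc | hc⟩
  · rw [C_eq]
    exact hshift 0 c (by rw [hc]; push_cast; ring)
  · exact (hshift (1 / 2) (c + 1) (by rw [hc]; push_cast; ring)).trans
      (tsum_rpow_neg_half_sq_le hx)

theorem C_anti {x y : ℝ} (hx : 1 < x) (hxy : x ≤ y) : C y ≤ C x := by
  rw [C_eq, C_eq]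
  refine (summable_rpow_neg_sq (hx.trans_le hxy) 0).tsum_le_tsum (fun r => ?_)
    (summable_rpow_neg_sq hx 0)
  rw [rpow_neg (by linarith), rpow_neg (by linarith)]
  gcongr

theorem one_le_C {x : ℝ} (hx : 1 < x) : 1 ≤ C x := by
  simpa using sum_rpow_neg_sq_le_C hx 0

theorem zpow_neg_succ_lt_one {x : ℝ} (hx : 1 < x) (j : ℕ) :
    0 < x ^ (-((j : ℤ) + 1)) ∧ x ^ (-((j : ℤ) + 1)) < 1 :=
  ⟨zpow_pos (by linarith) _, zpow_lt_one_of_neg₀ hx (by omega)⟩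

theorem one_le_factor {x : ℝ} (hx : 1 < x) (j : ℕ) :
    1 ≤ 1 / (1 - x ^ (-((j : ℤ) + 1))) := by
  obtain ⟨h0, h1⟩ := zpow_neg_succ_lt_one hx j
  rw [le_div_iff₀ (by linarith)]
  linarith

theorem multipliable_factor {x : ℝ} (hx : 1 < x) :
    Multipliable fun j : ℕ => 1 / (1 - x ^ (-((j : ℤ) + 1))) := by
  have hx0 : 0 < x := by linarith
  have hpow : ∀ j : ℕ, x ^ (-((j : ℤ) + 1)) = x⁻¹ ^ (j + 1) := fun j => by
    rw [zpow_neg, inv_pow]; norm_cast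
  have hlt : x⁻¹ < 1 := inv_lt_one_of_one_lt₀ hx
  have hs : Summable fun j : ℕ => x⁻¹ ^ (j + 1) / (1 - x⁻¹) :=
    ((summable_nat_add_iff 1).2 (summable_geometric_of_lt_one (by positivity) hlt)).div_const _
  have hs' : Summable fun j : ℕ => x ^ (-((j : ℤ) + 1)) / (1 - x ^ (-((j : ℤ) + 1))) := by
    refine hs.of_nonneg_of_le (fun j => ?_) fun j => ?_
    · obtain ⟨h0, h1⟩ := zpow_neg_succ_lt_one hx j
      exact div_nonneg h0.le (by linarith)
    · rw [hpow]
      have : x⁻¹ ^ (j + 1) ≤ x⁻¹ := pow_le_of_le_one (by positivity) hlt.le (by omega)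
      exact div_le_div_of_nonneg_left (by positivity) (by linarith) (by linarith)
  refine (Real.multipliable_one_add_of_summable hs').congr fun j => ?_
  obtain ⟨h0, h1⟩ := zpow_neg_succ_lt_one hx j
  have : 1 - x ^ (-((j : ℤ) + 1)) ≠ 0 := by linarith
  rw [one_add_div this]
  congr 1
  ring

theorem prod_le_D {x : ℝ} (hx : 1 < x) (k : ℕ) :
    ∏ j ∈ range k, 1 / (1 - x ^ (-((j : ℤ) + 1))) ≤ D x := by
  have hm : Monotone fun k => ∏ j ∈ range k, 1 / (1 - x ^ (-((j : ℤ) + 1))) := by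
    refine monotone_nat_of_le_succ fun k => ?_
    rw [prod_range_succ]
    exact le_mul_of_one_le_right
      (prod_nonneg fun j _ => zero_le_one.trans (one_le_factor hx j)) (one_le_factor hx k)
  exact hm.ge_of_tendsto (multipliable_factor hx).hasProd.tendsto_prod_nat k

theorem one_le_D {x : ℝ} (hx : 1 < x) : 1 ≤ D x := by
  simpa using prod_le_D hx 0

theorem D_anti {x y : ℝ} (hx : 1 < x) (hxy : x ≤ y) : D y ≤ D x := by
  have hy : 1 < y := hx.trans_le hxy
  refine le_of_tendsto (multipliable_factor hy).hasProd.tendsto_prod_nat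
    (Filter.Eventually.of_forall fun k => le_trans ?_ (prod_le_D hx k))
  refine prod_le_prod (fun j _ => zero_le_one.trans (one_le_factor hy j)) fun j _ => ?_
  have h1 := (zpow_neg_succ_lt_one hx j).2
  have : y ^ (-((j : ℤ) + 1)) ≤ x ^ (-((j : ℤ) + 1)) := by
    rw [zpow_neg, zpow_neg]
    norm_cast
    gcongr
  exact one_div_le_one_div_of_le (by linarith) (by linarith)

/-! ### Upper bounds for Gaussian coefficients and Galois numbers. -/

theorem gaussCoeff_le {q : ℝ} (hq : 1 < q) {n k : ℕ} (hk : k ≤ n) :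
    gaussCoeff n k q ≤ D q * q ^ (k * (n - k)) := by
  have hq0 : 0 < q := by linarith
  refine le_trans ?_ (mul_le_mul_of_nonneg_right (prod_le_D hq k) (by positivity))
  have e0 : q ^ (k * (n - k)) = ∏ _i ∈ range k, q ^ (n - k) := by
    rw [prod_const, card_range, ← pow_mul, mul_comm]
  -- After reversal, the i-th factor is compared with the Euler factor of exponent k - i.
  rw [gaussCoeff, ← prod_div_distrib, ← prod_range_reflect (fun j : ℕ => 1 / _), e0,
    ← prod_mul_distrib]
  refine prod_le_prod (fun i hi => ?_) fun i hi => ?_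
  · rw [mem_range] at hi
    have h1 : q ^ i < q ^ k := pow_lt_pow_right₀ hq hi
    have h2 : q ^ k ≤ q ^ n := pow_le_pow_right₀ hq.le hk
    exact div_nonneg (by linarith) (by linarith)
  · rw [mem_range] at hi
    have h1 : q ^ i < q ^ k := pow_lt_pow_right₀ hq hi
    have e : q ^ (-(((k - 1 - i : ℕ) : ℤ) + 1)) = q ^ i / q ^ k := by
      rw [← zpow_natCast, ← zpow_natCast, ← zpow_sub₀ hq0.ne']
      congr 1
      omega
    have e2 : q ^ n = q ^ k * q ^ (n - k) := by rw [← pow_add]; congr 1; omega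
    have h3 : 0 < q ^ k := by positivity
    have h4 : 0 < q ^ k - q ^ i := by linarith
    rw [e, e2, one_sub_div h3.ne', one_div_div, div_mul_eq_mul_div]
    refine div_le_div_of_nonneg_right ?_ h4.le
    have : 0 < q ^ i := by positivity
    linarith

theorem sum_pow_mul_sub_le {q : ℝ} (hq : 1 < q) (n : ℕ) :
    ∑ k ∈ range (n + 1), q ^ (k * (n - k)) ≤ C q * q ^ ((n : ℝ) ^ 2 / 4) := by
  have hq0 : 0 < q := by linarith
  refine le_trans (le_of_eq ?_)
    (mul_le_mul_of_nonneg_right (sum_rpow_neg_sq_le_C hq n) (rpow_nonneg hq0.le _))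
  rw [sum_mul]
  refine sum_congr rfl fun k hk => ?_
  rw [mem_range] at hk
  rw [← rpow_add hq0, ← rpow_natCast]
  congr 1
  rw [Nat.cast_mul, Nat.cast_sub (by omega)]
  ring

theorem galoisNumber_le {q : ℝ} (hq : 1 < q) (n : ℕ) :
    galoisNumber n q ≤ C q * D q * q ^ ((n : ℝ) ^ 2 / 4) := by
  calc galoisNumber n q ≤ ∑ k ∈ range (n + 1), D q * q ^ (k * (n - k)) :=
        sum_le_sum fun k hk => gaussCoeff_le hq (by rw [mem_range] at hk; omega)
    _ = D q * ∑ k ∈ range (n + 1), q ^ (k * (n - k)) := by rw [mul_sum]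
    _ ≤ D q * (C q * q ^ ((n : ℝ) ^ 2 / 4)) :=
        mul_le_mul_of_nonneg_left (sum_pow_mul_sub_le hq n) (zero_le_one.trans (one_le_D hq))
    _ = _ := by ring

/-! ### Counting subspaces over a finite field. -/

section Subspaces

theorem one_lt_card_field (K : Type*) [Field K] [Fintype K] : (1 : ℝ) < Fintype.card K := by
  exact_mod_cast Fintype.one_lt_card (α := K)

variable {K V U L : Type*} [Field K]
  [AddCommGroup V] [Module K V] [Finite V]
  [AddCommGroup U] [Module K U] [Finite U]
  [AddCommGroup L] [Module K L] [Finite L]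

/-- Linearly independent families spanning `W` are the linearly independent families in `W`. -/
noncomputable def linearIndependentSpanEquiv {k : ℕ} (W : Submodule K V)
    (hW : Module.finrank K W = k) :
    {s : {s : Fin k → V // LinearIndependent K s} // Submodule.span K (Set.range s.1) = W} ≃
      {t : Fin k → W // LinearIndependent K t} where
  toFun s := ⟨fun i => ⟨s.1.1 i, s.2.le (Submodule.subset_span ⟨i, rfl⟩)⟩,
    LinearIndependent.of_comp W.subtype s.1.2⟩
  invFun t := ⟨⟨fun i => (t.1 i : V), t.2.map' W.subtype W.ker_subtype⟩, by
    refine Submodule.eq_of_le_of_finrank_eq (Submodule.span_le.2 ?_) ?_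
    · rintro _ ⟨i, rfl⟩
      exact (t.1 i).2
    · have h : LinearIndependent K fun i => (t.1 i : V) := t.2.map' W.subtype W.ker_subtype
      rw [hW]
      exact (finrank_span_eq_card h).trans (Fintype.card_fin k)⟩
  left_inv s := rfl
  right_inv t := rfl

/-- The subspaces of `U × L` with given intersection with `U` and given projection to `L` are
determined by lifts of a basis of the projection. -/
theorem card_fiber_le (A : Submodule K U) (B : Submodule K L) :
    Nat.card {W : Submodule K (U × L) // W.comap (LinearMap.inl K U L) = A ∧
      W.map (LinearMap.snd K U L) = B} ≤ Nat.card (U ⧸ A) ^ Module.finrank K B := by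
  have : Finite (U ⧸ A) := Finite.of_surjective _ A.mkQ_surjective
  let β := Module.finBasis K B
  have hex : ∀ (W : {W : Submodule K (U × L) // W.comap (LinearMap.inl K U L) = A ∧
      W.map (LinearMap.snd K U L) = B}) (i : Fin (Module.finrank K B)),
      ∃ u : U, (u, (β i : L)) ∈ W.1 := by
    intro W i
    obtain ⟨⟨u, l⟩, hw, e⟩ := W.2.2.ge (β i).2
    exact ⟨u, by rw [← e]; exact hw⟩
  choose u hu using hex
  have hinj : Function.Injective fun W i => A.mkQ (u W i) := by
    have hle : ∀ W W', (fun i => A.mkQ (u W i)) = (fun i => A.mkQ (u W' i)) → W.1 ≤ W'.1 := by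
      rintro W W' h ⟨x, y⟩ hw
      have hy : y ∈ B := by rw [← W.2.2]; exact ⟨_, hw, rfl⟩
      set c := β.repr ⟨y, hy⟩
      have hsum : ∀ X, (∑ i, c i • u X i, y) ∈ X.1 := by
        intro X
        have h1 : ∑ i, c i • ((u X i, (β i : L)) : U × L) ∈ X.1 :=
          Submodule.sum_mem _ fun i _ => Submodule.smul_mem _ _ (hu X i)
        have h2 : ∑ i, c i • (β i : L) = y := by
          simpa only [map_sum, map_smul, Submodule.subtype_apply] using
            congrArg B.subtype (β.sum_repr ⟨y, hy⟩)
        convert h1 using 1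
        ext
        · simp [Prod.fst_sum]
        · simp [Prod.snd_sum, h2]
      have hA : ∀ X : {W : Submodule K (U × L) // W.comap (LinearMap.inl K U L) = A ∧
          W.map (LinearMap.snd K U L) = B}, ∀ a, a ∈ A ↔ ((a, 0) : U × L) ∈ X.1 := by
        intro X a
        conv_lhs => rw [← X.2.1]
        rfl
      -- Two vectors of W over the same y differ by an element of A.
      have h3 : x - ∑ i, c i • u W i ∈ A := by
        rw [hA W]
        simpa using W.1.sub_mem hw (hsum W)
      have h4 : ∑ i, c i • u W i - ∑ i, c i • u W' i ∈ A := by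
        rw [← sum_sub_distrib]
        refine A.sum_mem fun i _ => ?_
        rw [← smul_sub]
        exact A.smul_mem _ ((Submodule.Quotient.eq A).1 (congrFun h i))
      have h5 := W'.1.add_mem ((hA W' _).1 (A.add_mem h3 h4)) (hsum W')
      simpa using h5
    intro W W' h
    exact Subtype.ext (le_antisymm (hle W W' h) (hle W' W h.symm))
  have := Nat.card_le_card_of_injective _ hinj
  rwa [Nat.card_fun, Nat.card_fin] at this

variable [Fintype K]

variable (K V) in
-- Double counting: group the independent k-tuples of V by their span.
theorem card_subspaces_mul (k : ℕ) (hk : k ≤ Module.finrank K V) :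
    Nat.card {W : Submodule K V // Module.finrank K W = k} *
      ∏ i : Fin k, (Fintype.card K ^ k - Fintype.card K ^ (i : ℕ)) =
      ∏ i : Fin k, (Fintype.card K ^ Module.finrank K V - Fintype.card K ^ (i : ℕ)) := by
  classical
  have := Fintype.ofFinite {W : Submodule K V // Module.finrank K W = k}
  rw [← card_linearIndependent hk]
  let f : {s : Fin k → V // LinearIndependent K s} →
      {W : Submodule K V // Module.finrank K W = k} := fun s =>
    ⟨Submodule.span K (Set.range s.1), by rw [finrank_span_eq_card s.2, Fintype.card_fin]⟩
  rw [← Nat.card_congr (Equiv.sigmaFiberEquiv f), Nat.card_sigma]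
  have h : ∀ W : {W : Submodule K V // Module.finrank K W = k},
      Nat.card {s // f s = W} =
        ∏ i : Fin k, (Fintype.card K ^ k - Fintype.card K ^ (i : ℕ)) := by
    rintro ⟨W, hW⟩
    have h1 := card_linearIndependent (K := K) (V := W) hW.ge
    rw [hW] at h1
    rw [← h1, ← Nat.card_congr (linearIndependentSpanEquiv W hW)]
    exact Nat.card_congr (Equiv.subtypeEquivRight fun s => by simp [f])
  simp_rw [h]
  rw [sum_const, smul_eq_mul, card_univ, Nat.card_eq_fintype_card]

variable (K V) in
theorem card_subspaces_finrank (k : ℕ) (hk : k ≤ Module.finrank K V) :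
    (Nat.card {W : Submodule K V // Module.finrank K W = k} : ℝ) =
      gaussCoeff (Module.finrank K V) k (Fintype.card K) := by
  have hq := one_lt_card_field K
  have hcast : ∀ m, k ≤ m →
      ((∏ i : Fin k, (Fintype.card K ^ m - Fintype.card K ^ (i : ℕ)) : ℕ) : ℝ) =
      ∏ i ∈ range k, ((Fintype.card K : ℝ) ^ m - (Fintype.card K : ℝ) ^ i) := by
    intro m hm
    rw [← Fin.prod_univ_eq_prod_range fun i => (Fintype.card K : ℝ) ^ m - (Fintype.card K : ℝ) ^ i]
    push_cast
    refine prod_congr rfl fun i _ => ?_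
    rw [Nat.cast_sub (Nat.pow_le_pow_right Fintype.card_pos (i.2.le.trans hm))]
    push_cast
    rfl
  have h := congrArg (Nat.cast (R := ℝ)) (card_subspaces_mul K V k hk)
  rw [Nat.cast_mul, hcast k le_rfl, hcast _ hk] at h
  rw [gaussCoeff, eq_div_iff, h]
  refine (prod_pos fun i hi => ?_).ne'
  rw [mem_range] at hi
  exact sub_pos.2 (pow_lt_pow_right₀ hq hi)

variable (K V) in
theorem sum_subspaces [Fintype (Submodule K V)] (f : ℕ → ℝ) :
    ∑ W : Submodule K V, f (Module.finrank K W) =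
      ∑ k ∈ range (Module.finrank K V + 1),
        gaussCoeff (Module.finrank K V) k (Fintype.card K) * f k := by
  classical
  rw [← sum_fiberwise_of_maps_to (t := range (Module.finrank K V + 1))
    (g := fun W : Submodule K V => Module.finrank K W)
    fun W _ => mem_range.2 (Nat.lt_succ_of_le W.finrank_le)]
  refine sum_congr rfl fun k hk => ?_
  rw [← card_subspaces_finrank K V k (Nat.lt_succ_iff.1 (mem_range.1 hk)),
    sum_congr rfl fun W hW => by rw [(mem_filter.1 hW).2], sum_const, nsmul_eq_mul,
    Nat.card_eq_fintype_card, Fintype.card_subtype]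

variable (K V) in
theorem card_submodule_eq_galoisNumber :
    (Nat.card (Submodule K V) : ℝ) = galoisNumber (Module.finrank K V) (Fintype.card K) := by
  classical
  have := Fintype.ofFinite (Submodule K V)
  have h := sum_subspaces K V fun _ => 1
  simpa [galoisNumber, Nat.card_eq_fintype_card] using h

/-- The weight costs nothing: with b = dim E and k = dim A/E, the term is at most D q^((k+b)(n-k)),
which is D times the (k+b)-th term of the sum that bounds the Galois number of U. Hence the bound
does not depend on E. -/
theorem sum_quotient_card_le [Fintype (Submodule K U)] [DecidableLE (Submodule K U)]
    (E : Submodule K U) :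
    ∑ A : Submodule K U, (if E ≤ A then (Nat.card (U ⧸ A) : ℝ) ^ Module.finrank K E else 0) ≤
      C (Fintype.card K) * D (Fintype.card K) *
        (Fintype.card K : ℝ) ^ ((Module.finrank K U : ℝ) ^ 2 / 4) := by
  classical
  have : Finite (U ⧸ E) := Finite.of_surjective _ E.mkQ_surjective
  have := Fintype.ofFinite (Submodule K (U ⧸ E))
  set q : ℝ := (Fintype.card K : ℝ)
  have hq : 1 < q := one_lt_card_field K
  set b := Module.finrank K E
  set n := Module.finrank K (U ⧸ E) with hn
  have hnb : n + b = Module.finrank K U := E.finrank_quotient_add_finrank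
  have h1 : ∑ A : Submodule K U, (if E ≤ A then (Nat.card (U ⧸ A) : ℝ) ^ b else 0) =
      ∑ A : Submodule K (U ⧸ E), q ^ (b * (n - Module.finrank K A)) := by
    rw [← sum_filter]
    symm
    refine sum_nbij' (fun A => A.comap E.mkQ) (fun A => A.map E.mkQ) (fun A _ => ?_)
      (fun _ _ => mem_univ _) (fun A _ => Submodule.map_comap_eq_of_surjective E.mkQ_surjective A)
      (fun A hA => ?_) fun A _ => ?_
    · exact mem_filter.2 ⟨mem_univ _, Submodule.le_comap_mkQ E A⟩
    · rw [Submodule.comap_map_mkQ, sup_eq_right]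
      exact (mem_filter.1 hA).2
    · have e := Submodule.quotientQuotientEquivQuotient E _ (Submodule.le_comap_mkQ E A)
      rw [Submodule.map_comap_eq_of_surjective E.mkQ_surjective] at e
      have hd := A.finrank_quotient_add_finrank
      rw [← hn] at hd
      have : Finite ((U ⧸ E) ⧸ A) := Finite.of_surjective _ A.mkQ_surjective
      rw [← Nat.card_congr e.toEquiv, Module.natCard_eq_pow_finrank (K := K),
        Nat.card_eq_fintype_card, ← hd, Nat.add_sub_cancel, mul_comm b, pow_mul, Nat.cast_pow]
  rw [h1, sum_subspaces K (U ⧸ E) fun k => q ^ (b * (n - k))]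
  calc _ ≤ ∑ k ∈ range (n + 1), D q * q ^ ((k + b) * (n + b - (k + b))) := by
        refine sum_le_sum fun k hk => ?_
        have hk' : k ≤ n := Nat.lt_succ_iff.1 (mem_range.1 hk)
        refine (mul_le_mul_of_nonneg_right (gaussCoeff_le hq hk') (by positivity)).trans_eq ?_
        rw [mul_assoc, ← pow_add, Nat.add_sub_add_right, add_mul]
    _ = D q * ∑ k ∈ range (n + 1), q ^ ((k + b) * (n + b - (k + b))) := by rw [mul_sum]
    _ ≤ D q * ∑ k ∈ range (n + b + 1), q ^ (k * (n + b - k)) := by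
        refine mul_le_mul_of_nonneg_left ?_ (zero_le_one.trans (one_le_D hq))
        rw [show n + b + 1 = b + (n + 1) by omega, sum_range_add _ b (n + 1)]
        simp_rw [add_comm b]
        exact le_add_of_nonneg_left (sum_nonneg fun _ _ => by positivity)
    _ ≤ D q * (C q * q ^ (((n + b : ℕ) : ℝ) ^ 2 / 4)) :=
        mul_le_mul_of_nonneg_left (sum_pow_mul_sub_le hq _) (zero_le_one.trans (one_le_D hq))
    _ = _ := by rw [hnb]; ring

end Subspaces

/-! ### Subspaces invariant under an operator, and subspaces over an extension field. -/

section Invariant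

variable {K V U L : Type*} [Field K] [Fintype K]
  [AddCommGroup V] [Module K V] [Finite V]
  [AddCommGroup U] [Module K U] [Finite U]
  [AddCommGroup L] [Module K L] [Finite L]

/-- Invariance forces ν(B) ≤ A, where B is the projection of W to L and A its intersection with U.
Summing the fibre bound over A gives a factor uniform in B; the number of choices of B is the Galois
number of L. -/
theorem card_invariant_prod_le (ν : L →ₗ[K] U) (hν : Function.Injective ν) :
    (Nat.card {W : Submodule K (U × L) // ∀ w ∈ W, (ν w.2, (0 : L)) ∈ W} : ℝ) ≤
      (C (Fintype.card K) * D (Fintype.card K)) ^ 2 * (Fintype.card K : ℝ) ^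
        (((Module.finrank K L : ℝ) ^ 2 + (Module.finrank K U : ℝ) ^ 2) / 4) := by
  classical
  have := Fintype.ofFinite (Submodule K U)
  have := Fintype.ofFinite (Submodule K L)
  have hq := one_lt_card_field K
  have hC := one_le_C hq
  have hD := one_le_D hq
  let f : {W : Submodule K (U × L) // ∀ w ∈ W, (ν w.2, (0 : L)) ∈ W} →
      Submodule K L × Submodule K U := fun W =>
    (W.1.map (LinearMap.snd K U L), W.1.comap (LinearMap.inl K U L))
  have hfib : ∀ BA : Submodule K L × Submodule K U, (Nat.card {W // f W = BA} : ℝ) ≤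
      if BA.1.map ν ≤ BA.2 then (Nat.card (U ⧸ BA.2) : ℝ) ^ Module.finrank K (BA.1.map ν)
        else 0 := by
    rintro ⟨B, A⟩
    split_ifs with h
    · rw [← (Submodule.equivMapOfInjective ν hν B).finrank_eq]
      refine le_trans ?_ (Nat.cast_le.2 (card_fiber_le A B)) |>.trans_eq (by push_cast; rfl)
      refine Nat.cast_le.2 (Nat.card_le_card_of_injective (fun W => ⟨W.1.1, ?_⟩) ?_)
      · exact ⟨congrArg Prod.snd W.2, congrArg Prod.fst W.2⟩
      · intro W W' e
        have e' : W.1.1 = W'.1.1 := by simpa only [Subtype.mk.injEq] using e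
        exact Subtype.ext (Subtype.ext e')
    · have : IsEmpty {W // f W = (B, A)} := by
        refine ⟨fun W => h ?_⟩
        rintro _ ⟨l, hl, rfl⟩
        obtain ⟨w, hw, rfl⟩ := (congrArg Prod.fst W.2).ge hl
        exact (congrArg Prod.snd W.2).le (W.1.2 w hw)
      simp
  rw [← Nat.card_congr (Equiv.sigmaFiberEquiv f), Nat.card_sigma, Nat.cast_sum]
  calc _ ≤ _ := sum_le_sum fun BA _ => hfib BA
    _ = ∑ B : Submodule K L, ∑ A : Submodule K U, (if B.map ν ≤ A then
          (Nat.card (U ⧸ A) : ℝ) ^ Module.finrank K (B.map ν) else 0) := Fintype.sum_prod_type _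
    _ ≤ ∑ _B : Submodule K L, C (Fintype.card K) * D (Fintype.card K) *
        (Fintype.card K : ℝ) ^ ((Module.finrank K U : ℝ) ^ 2 / 4) :=
      sum_le_sum fun B _ => sum_quotient_card_le (B.map ν)
    _ = galoisNumber (Module.finrank K L) (Fintype.card K) *
        (C (Fintype.card K) * D (Fintype.card K) *
        (Fintype.card K : ℝ) ^ ((Module.finrank K U : ℝ) ^ 2 / 4)) := by
      rw [sum_const, nsmul_eq_mul, card_univ, ← Nat.card_eq_fintype_card,
        card_submodule_eq_galoisNumber]
    _ ≤ (C (Fintype.card K) * D (Fintype.card K) *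
        (Fintype.card K : ℝ) ^ ((Module.finrank K L : ℝ) ^ 2 / 4)) *
        (C (Fintype.card K) * D (Fintype.card K) *
        (Fintype.card K : ℝ) ^ ((Module.finrank K U : ℝ) ^ 2 / 4)) :=
      mul_le_mul_of_nonneg_right (galoisNumber_le hq _) (by positivity)
    _ = _ := by
      rw [add_div, rpow_add (by linarith)]
      ring

theorem sq_add_sq_le_of_add_eq {a b m : ℕ} (ha : 1 ≤ a) (hb : 1 ≤ b) (h : a + b = m) :
    ((a : ℝ) ^ 2 + (b : ℝ) ^ 2) / 4 ≤ ((m : ℝ) ^ 2 - 2 * m + 2) / 4 := by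
  subst h
  have ha' : (1 : ℝ) ≤ a := by exact_mod_cast ha
  have hb' : (1 : ℝ) ≤ b := by exact_mod_cast hb
  push_cast
  nlinarith [mul_nonneg (sub_nonneg.2 ha') (sub_nonneg.2 hb')]

theorem card_invariant_le_of_sq_zero (N : V →ₗ[K] V) (hN : N ≠ 0) (hN2 : ∀ v, N (N v) = 0) :
    (Nat.card {W : Submodule K V // ∀ w ∈ W, N w ∈ W} : ℝ) ≤
      (C (Fintype.card K) * D (Fintype.card K)) ^ 2 * (Fintype.card K : ℝ) ^
        (((Module.finrank K V : ℝ) ^ 2 - 2 * Module.finrank K V + 2) / 4) := by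
  have hq := one_lt_card_field K
  have hC := one_le_C hq
  have hD := one_le_D hq
  -- On ker N × L the operator is (u, l) ↦ (N l, 0), with N injective on L.
  obtain ⟨L, hL⟩ := (LinearMap.ker N).exists_isCompl
  let e := Submodule.prodEquivOfIsCompl _ _ hL
  let ν : L →ₗ[K] LinearMap.ker N := (N.comp L.subtype).codRestrict _ fun l => hN2 l
  have hν : Function.Injective ν := by
    rw [← LinearMap.ker_eq_bot, LinearMap.ker_eq_bot']
    intro l hl
    exact Subtype.ext
      (Submodule.disjoint_def.1 hL.disjoint l (congrArg (LinearMap.ker N).subtype hl) l.2)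
  have hdim : Module.finrank K L + Module.finrank K (LinearMap.ker N) = Module.finrank K V := by
    rw [add_comm]
    exact Submodule.finrank_add_eq_of_isCompl hL
  have hle := LinearMap.finrank_le_finrank_of_injective hν
  have hpos : 1 ≤ Module.finrank K L := by
    by_contra h
    have h0 : L = ⊥ := Submodule.finrank_eq_zero.1 (by omega)
    have h1 := hL.sup_eq_top
    rw [h0, sup_bot_eq, LinearMap.ker_eq_top] at h1
    exact hN h1
  have hcard : Nat.card {W : Submodule K V // ∀ w ∈ W, N w ∈ W} ≤
      Nat.card {W : Submodule K (LinearMap.ker N × L) // ∀ w ∈ W, (ν w.2, (0 : L)) ∈ W} := by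
    refine Nat.card_le_card_of_injective (fun W => ⟨W.1.comap e.toLinearMap, ?_⟩) ?_
    · rintro ⟨u, l⟩ hw
      have h := W.2 _ hw
      have hu : N u = 0 := u.2
      have he : e (ν l, 0) = N (e (u, l)) := by simp [e, hu, show (ν l : V) = N l from rfl]
      exact (congrArg (· ∈ W.1) he).mpr h
    · intro W W' h
      exact Subtype.ext (Submodule.comap_injective_of_surjective e.surjective
        (congrArg Subtype.val h))
  refine (Nat.cast_le.2 hcard).trans ((card_invariant_prod_le ν hν).trans ?_)
  exact mul_le_mul_of_nonneg_left (rpow_le_rpow_of_exponent_le hq.le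
    (sq_add_sq_le_of_add_eq hpos (hpos.trans hle) hdim)) (by positivity)

/-- An invariant subspace is the direct sum of its intersections with the range and the kernel of P.
-/
theorem card_invariant_le_of_idempotent (P : V →ₗ[K] V) (hP : ∀ v, P (P v) = P v)
    (h0 : P ≠ 0) (h1 : P ≠ LinearMap.id) :
    (Nat.card {W : Submodule K V // ∀ w ∈ W, P w ∈ W} : ℝ) ≤
      (C (Fintype.card K) * D (Fintype.card K)) ^ 2 * (Fintype.card K : ℝ) ^
        (((Module.finrank K V : ℝ) ^ 2 - 2 * Module.finrank K V + 2) / 4) := by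
  have hq := one_lt_card_field K
  have hC := one_le_C hq
  have hD := one_le_D hq
  have hr : 1 ≤ Module.finrank K (LinearMap.range P) := by
    by_contra h
    exact h0 (LinearMap.range_eq_bot.1 (Submodule.finrank_eq_zero.1 (by omega)))
  have hk : 1 ≤ Module.finrank K (LinearMap.ker P) := by
    by_contra h
    have hb : LinearMap.ker P = ⊥ := Submodule.finrank_eq_zero.1 (by omega)
    exact h1 (LinearMap.ext fun v => LinearMap.ker_eq_bot.1 hb (hP v))
  have hcard : Nat.card {W : Submodule K V // ∀ w ∈ W, P w ∈ W} ≤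
      Nat.card (Submodule K (LinearMap.range P) × Submodule K (LinearMap.ker P)) := by
    refine Nat.card_le_card_of_injective
      (fun W => (W.1.comap (LinearMap.range P).subtype, W.1.comap (LinearMap.ker P).subtype)) ?_
    have key : ∀ W : {W : Submodule K V // ∀ w ∈ W, P w ∈ W}, ∀ v, v ∈ W.1 ↔
        P v ∈ W.1 ∧ v - P v ∈ W.1 := fun W v =>
      ⟨fun h => ⟨W.2 v h, W.1.sub_mem h (W.2 v h)⟩,
        fun h => by simpa using W.1.add_mem h.1 h.2⟩
    intro W W' h
    refine Subtype.ext (Submodule.ext fun v => ?_)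
    have e1 := SetLike.ext_iff.1 (congrArg Prod.fst h) ⟨P v, v, rfl⟩
    have e2 := SetLike.ext_iff.1 (congrArg Prod.snd h) ⟨v - P v, by simp [hP]⟩
    rw [key W, key W']
    exact and_congr e1 e2
  refine (Nat.cast_le.2 hcard).trans ?_
  rw [Nat.card_prod, Nat.cast_mul, card_submodule_eq_galoisNumber, card_submodule_eq_galoisNumber]
  have hexp := sq_add_sq_le_of_add_eq hr hk P.finrank_range_add_finrank_ker
  calc _ ≤ (C (Fintype.card K) * D (Fintype.card K) *
        (Fintype.card K : ℝ) ^ ((Module.finrank K (LinearMap.range P) : ℝ) ^ 2 / 4)) *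
        (C (Fintype.card K) * D (Fintype.card K) *
        (Fintype.card K : ℝ) ^ ((Module.finrank K (LinearMap.ker P) : ℝ) ^ 2 / 4)) := by
        refine mul_le_mul (galoisNumber_le hq _) (galoisNumber_le hq _) ?_ (by positivity)
        rw [← card_submodule_eq_galoisNumber]
        positivity
    _ = (C (Fintype.card K) * D (Fintype.card K)) ^ 2 * (Fintype.card K : ℝ) ^
        (((Module.finrank K (LinearMap.range P) : ℝ) ^ 2 +
          (Module.finrank K (LinearMap.ker P) : ℝ) ^ 2) / 4) := by
      rw [add_div, rpow_add (by linarith)]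
      ring
    _ ≤ _ := mul_le_mul_of_nonneg_left (rpow_le_rpow_of_exponent_le hq.le hexp) (by positivity)

theorem card_submodule_le_of_extension {F : Type*} [Field F] [Finite F] [Algebra K F]
    [Module F V] [IsScalarTower K F V] (he : 2 ≤ Module.finrank K F) :
    (Nat.card (Submodule F V) : ℝ) ≤
      (C (Fintype.card K) * D (Fintype.card K)) ^ 2 * (Fintype.card K : ℝ) ^
        (((Module.finrank K V : ℝ) ^ 2 - 2 * Module.finrank K V + 2) / 4) := by
  have := Fintype.ofFinite F
  have hq := one_lt_card_field K
  have hq0 : (0 : ℝ) < Fintype.card K := by linarith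
  have hC := one_le_C hq
  have hD := one_le_D hq
  have hQ := one_lt_card_field F
  have hC' := one_le_C hQ
  have hD' := one_le_D hQ
  have hcard : (Fintype.card F : ℝ) = (Fintype.card K : ℝ) ^ (Module.finrank K F : ℝ) := by
    rw [rpow_natCast]
    exact_mod_cast Module.card_eq_pow_finrank (K := K) (V := F)
  have hle : (Fintype.card K : ℝ) ≤ Fintype.card F := by
    rw [hcard]
    exact self_le_rpow_of_one_le hq.le (by exact_mod_cast (by omega : 1 ≤ Module.finrank K F))
  have hm := Module.finrank_mul_finrank K F V
  rw [card_submodule_eq_galoisNumber]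
  refine (galoisNumber_le hQ _).trans (mul_le_mul ?_ ?_ (by positivity) (by positivity))
  · calc C (Fintype.card F) * D (Fintype.card F)
        ≤ C (Fintype.card K) * D (Fintype.card K) :=
          mul_le_mul (C_anti hq hle) (D_anti hq hle) (by positivity) (by positivity)
      _ ≤ _ := by
          rw [sq]
          exact le_mul_of_one_le_right (by positivity) (one_le_mul_of_one_le_of_one_le hC hD)
  · rw [hcard, ← rpow_mul hq0.le]
    refine rpow_le_rpow_of_exponent_le hq.le ?_
    rw [← hm]
    push_cast
    have h2 : (2 : ℝ) ≤ Module.finrank K F := by exact_mod_cast he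
    generalize (Module.finrank K F : ℝ) = e at *
    generalize (Module.finrank F V : ℝ) = n at *
    have h3 : 0 ≤ e * (e - 2) * n ^ 2 := by
      have := sub_nonneg.2 h2
      positivity
    -- Here e n = m: the claim follows from e n² ≤ m²/2 and (m-2)² ≥ 0.
    nlinarith [sq_nonneg (e * n - 2)]

end Invariant

/-! ### Reduction of a commutative algebra action to the three cases. -/

section Algebra

theorem card_submodule_le_card_invariant {K A V : Type*} [Field K] [CommRing A] [Algebra K A]
    [AddCommGroup V] [Module K V] [Finite V] [Module A V] [IsScalarTower K A V] (a : A) :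
    Nat.card (Submodule A V) ≤
      Nat.card {W : Submodule K V // ∀ w ∈ W, Algebra.lsmul K K V a w ∈ W} := by
  refine Nat.card_le_card_of_injective
    (fun W => ⟨W.restrictScalars K, fun w hw => W.smul_mem a hw⟩) ?_
  intro W W' h
  exact Submodule.restrictScalars_injective K A V (congrArg Subtype.val h)

variable {K A V : Type*} [Field K] [Fintype K] [CommRing A] [Algebra K A]
  [AddCommGroup V] [Module K V] [Finite V] [Module A V] [IsScalarTower K A V]

theorem exists_pow_idempotent {E : Type*} [Monoid E] [Finite E] (x : E) :
    ∃ n, n ≠ 0 ∧ x ^ n * x ^ n = x ^ n := by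
  obtain ⟨i, j, hne, h⟩ := Finite.exists_ne_map_eq_of_infinite fun n : ℕ => x ^ n
  wlog hij : i < j generalizing i j
  · exact this j i hne.symm h.symm (by omega)
  obtain ⟨d, rfl⟩ := Nat.exists_eq_add_of_lt hij
  have hstep : ∀ t n, i ≤ n → x ^ (n + t * (d + 1)) = x ^ n := by
    intro t
    induction t with
    | zero => simp
    | succ t ih =>
      intro n hn
      obtain ⟨c, rfl⟩ := Nat.exists_eq_add_of_le hn
      rw [← ih _ hn, show i + c + (t + 1) * (d + 1) = (i + d + 1) + (c + t * (d + 1)) by ring,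
        pow_add, ← h, ← pow_add]
      congr 1
      ring
  -- Powers have period d + 1 from exponent i on; this exponent is a multiple of the period and at
  -- least i.
  refine ⟨(i + 1) * (d + 1), by positivity, ?_⟩
  rw [← pow_add]
  exact hstep (i + 1) _ (by nlinarith)

theorem card_submodule_le_of_not_scalar (a : A) (ha : ¬ ∃ c : K, ∀ v : V, a • v = c • v) :
    (Nat.card (Submodule A V) : ℝ) ≤
      (C (Fintype.card K) * D (Fintype.card K)) ^ 2 * (Fintype.card K : ℝ) ^
        (((Module.finrank K V : ℝ) ^ 2 - 2 * Module.finrank K V + 2) / 4) := by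
  set I := Module.annihilator A V with hI
  have hmem : ∀ x : A, x ∈ I ↔ ∀ v : V, x • v = 0 := fun x => Module.mem_annihilator
  by_cases hrad : I.IsRadical
  swap
  · rw [Ideal.isRadical_iff_pow_one_lt 2 one_lt_two] at hrad
    push Not at hrad
    obtain ⟨x, hx2, hx⟩ := hrad
    refine (Nat.cast_le.2 (card_submodule_le_card_invariant (K := K) x)).trans
      (card_invariant_le_of_sq_zero _ (fun h => hx ?_) fun v => ?_)
    · exact (hmem x).2 fun v => LinearMap.congr_fun h v
    · have := (hmem _).1 hx2 v
      rwa [sq, mul_smul] at this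
  by_cases hreg : ∀ x, x ∉ I → ∀ v : V, x • v = 0 → v = 0
  swap
  · push Not at hreg
    obtain ⟨x, hx, v, hxv, hv⟩ := hreg
    have : Finite (V →ₗ[K] V) := DFunLike.finite _
    obtain ⟨n, hn, hidem⟩ := exists_pow_idempotent (E := Module.End K V) (Algebra.lsmul K K V x)
    rw [← map_pow] at hidem
    refine (Nat.cast_le.2 (card_submodule_le_card_invariant (K := K) (x ^ n))).trans
      (card_invariant_le_of_idempotent _ (LinearMap.congr_fun hidem) (fun h => hx ?_)
        fun h => hv ?_)
    -- As I is radical, no power of x outside I acts as zero; as x kills v ≠ 0, no positive power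
    -- acts as the identity.
    · exact hrad ⟨n, (hmem _).2 fun v => LinearMap.congr_fun h v⟩
    · have h1 : x ^ n • v = v := LinearMap.congr_fun h v
      obtain ⟨k, rfl⟩ := Nat.exists_eq_succ_of_ne_zero hn
      rw [← h1, pow_succ, mul_smul, hxv, smul_zero]
  have hne : I ≠ ⊤ := by
    intro h
    refine ha ⟨0, fun v => ?_⟩
    rw [zero_smul]
    exact (hmem a).1 (h ▸ Submodule.mem_top) v
  have hprime : I.IsPrime := by
    refine ⟨hne, fun {x y} hxy => ?_⟩
    by_contra! h
    refine h.2 ((hmem y).2 fun v => hreg x h.1 _ ?_)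
    rw [← mul_smul]
    exact (hmem _).1 hxy v
  let _ : Module (A ⧸ I) V := Module.quotientAnnihilator
  have hsmul : ∀ (x : A) (v : V), Ideal.Quotient.mk I x • v = x • v := fun x v => rfl
  -- The quotient acts faithfully on the finite set V, and a finite domain is a field.
  have hfin : Finite (A ⧸ I) := by
    have hinj : Function.Injective fun (x : A ⧸ I) (v : V) => x • v := by
      intro x y h
      obtain ⟨x, rfl⟩ := Ideal.Quotient.mk_surjective x
      obtain ⟨y, rfl⟩ := Ideal.Quotient.mk_surjective y
      refine Ideal.Quotient.eq.2 ((hmem _).2 fun v => ?_)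
      rw [sub_smul, sub_eq_zero]
      exact congrFun h v
    exact Finite.of_injective _ hinj
  let _ : Field (A ⧸ I) := (Finite.isField_of_domain (A ⧸ I)).toField
  have : IsScalarTower K (A ⧸ I) V := by
    refine ⟨fun c x v => ?_⟩
    obtain ⟨x, rfl⟩ := Ideal.Quotient.mk_surjective x
    exact smul_assoc c x v
  -- In degree 1 the class of a would lie in K, making a scalar.
  have he : 2 ≤ Module.finrank K (A ⧸ I) := by
    have hpos : 0 < Module.finrank K (A ⧸ I) := Module.finrank_pos
    by_contra h
    have h1 : Module.finrank K (A ⧸ I) = 1 := by omega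
    have htop := Subalgebra.bot_eq_top_iff_finrank_eq_one.2 h1
    have hmk : Ideal.Quotient.mk I a ∈ (⊥ : Subalgebra K (A ⧸ I)) := by
      rw [htop]
      exact Algebra.mem_top
    obtain ⟨c, hc⟩ := Algebra.mem_bot.1 hmk
    refine ha ⟨c, fun v => ?_⟩
    rw [← hsmul, ← hc, algebraMap_smul]
  refine le_trans (Nat.cast_le.2 ?_) (card_submodule_le_of_extension (K := K) (F := A ⧸ I) he)
  refine Nat.card_le_card_of_injective (fun W : Submodule A V =>
    ({ W.toAddSubmonoid with
        smul_mem' := fun x v hv => by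
          obtain ⟨x, rfl⟩ := Ideal.Quotient.mk_surjective x
          exact W.smul_mem x hv } : Submodule (A ⧸ I) V)) ?_
  intro W W' h
  exact SetLike.ext' (congrArg (fun X : Submodule (A ⧸ I) V => (X : Set V)) h)

end Algebra

/-! ### The group algebra of a cyclic group. -/

theorem actsAsScalar_of (p d : ℕ) [Fact p.Prime] (g : Matrix.GeneralLinearGroup (Fin d) (ZMod p))
    {M : Type*} [AddCommGroup M] [Module (ZMod p) M] [Module (CyclicAlg p d g) M]
    [IsScalarTower (ZMod p) (CyclicAlg p d g) M] (h : ActsAsScalar p d g M)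
    (x : CyclicAlg p d g) : ∃ c : ZMod p, ∀ v : M, x • v = c • v := by
  obtain ⟨c, hc⟩ := h
  have hpow : ∀ n : ℕ, ∀ v : M, MonoidAlgebra.of (ZMod p) (Subgroup.zpowers g)
      (⟨g, Subgroup.mem_zpowers g⟩ ^ n) • v = c ^ n • v := by
    intro n
    induction n with
    | zero => intro v; rw [pow_zero, map_one, one_smul, pow_zero, one_smul]
    | succ n ih =>
      intro v
      rw [pow_succ, map_mul, mul_smul]
      exact (congrArg _ (hc v)).trans ((ih _).trans (by rw [pow_succ, mul_smul]))
  induction x using MonoidAlgebra.induction_on with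
  | of y =>
    obtain ⟨y, hy⟩ := y
    -- The group is finite, so natural powers of g suffice.
    obtain ⟨n, rfl⟩ := mem_powers_iff_mem_zpowers.2 hy
    exact ⟨c ^ n, hpow n⟩
  | add x y hx hy =>
    obtain ⟨a, ha⟩ := hx
    obtain ⟨b, hb⟩ := hy
    exact ⟨a + b, fun v => by rw [add_smul, add_smul, ha, hb]⟩
  | smul r x hx =>
    obtain ⟨a, ha⟩ := hx
    exact ⟨r * a, fun v => by rw [smul_assoc, ha, mul_smul]⟩

end SubmoduleCount

open SubmoduleCount in
theorem theorem6p2 (p : ℕ) [Fact p.Prime] (d : ℕ)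
    (g : Matrix.GeneralLinearGroup (Fin d) (ZMod p))
    (M : Type*) [AddCommGroup M] [Module (ZMod p) M]
    [Module (SubmoduleCount.CyclicAlg p d g) M]
    [IsScalarTower (ZMod p) (SubmoduleCount.CyclicAlg p d g) M] [Finite M] :
    (SubmoduleCount.ActsAsScalar p d g M ∧
      (∀ W : Submodule (ZMod p) M, ∃ N : Submodule (SubmoduleCount.CyclicAlg p d g) M,
        N.restrictScalars (ZMod p) = W) ∧
      (Nat.card (Submodule (SubmoduleCount.CyclicAlg p d g) M) : ℝ) =
        SubmoduleCount.galoisNumber (Module.finrank (ZMod p) M) p) ∨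
    (¬ SubmoduleCount.ActsAsScalar p d g M ∧
      Real.logb p (Nat.card (Submodule (SubmoduleCount.CyclicAlg p d g) M)) ≤
        ((Module.finrank (ZMod p) M : ℝ) ^ 2 - 2 * (Module.finrank (ZMod p) M : ℝ) + 2) / 4 +
          2 * Real.logb p (SubmoduleCount.C p * SubmoduleCount.D p)) := by
  by_cases h : ActsAsScalar p d g M
  · have hsurj : ∀ W : Submodule (ZMod p) M, ∃ N : Submodule (CyclicAlg p d g) M,
        N.restrictScalars (ZMod p) = W := fun W =>
      ⟨{ W.toAddSubmonoid with
          smul_mem' := fun x v hv => by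
            obtain ⟨c, hc⟩ := actsAsScalar_of p d g h x
            rw [hc]
            exact W.smul_mem c hv }, rfl⟩
    refine Or.inl ⟨h, hsurj, ?_⟩
    rw [Nat.card_congr (Equiv.ofBijective _
      ⟨Submodule.restrictScalars_injective (ZMod p) (CyclicAlg p d g) M, hsurj⟩),
      card_submodule_eq_galoisNumber, ZMod.card]
  · refine Or.inr ⟨h, ?_⟩
    let _ : CommGroup (Subgroup.zpowers g) :=
      { (inferInstance : Group (Subgroup.zpowers g)) with mul_comm := mul_comm' }
    let _ : CommRing (CyclicAlg p d g) := MonoidAlgebra.commRing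
    have hle := card_submodule_le_of_not_scalar (K := ZMod p) (V := M)
      (CyclicAlg.gen p d g) h
    rw [ZMod.card] at hle
    have hp : (1 : ℝ) < p := by exact_mod_cast (Fact.out : p.Prime).one_lt
    have hC := one_le_C hp
    have hD := one_le_D hp
    have hpos : (0 : ℝ) < Nat.card (Submodule (CyclicAlg p d g) M) :=
      Nat.cast_pos.2 Nat.card_pos
    refine (Real.logb_le_logb_of_le hp hpos hle).trans_eq ?_
    rw [Real.logb_mul (by positivity) (by positivity), Real.logb_rpow (by linarith) hp.ne',
      Real.logb_pow, add_comm]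
    norm_num
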